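/- **Model.** Let $G=(V,E)$ be a connected finite graph with $n=|V|$ nodes. Communication proceeds in synchronous rounds; in each round every node either transmits a packet or listens. A node receives a packet if and only if it listens and exactly one of its neighbours transmits; it then receives that neighbour's packet. All logarithms are to base $2$. A *layering* of $G$ with source $s$ is a map $\ell:V\to\mathbb Z$ such that $s$ is the only node with $\ell(s)=0$ and every $u\ne s$ has a neighbour $v$ with $\ell(v)<\ell(u)$; its *depth* is $D'=\max_u \ell(u)$. Together with a coloring $c:V\to\{0,\dots,C-1\}$ it is *$C$-collision-free* if $c(u)\neq c(v)$ whenever $\ell(u)\ne\ell(v)$ and $\mathrm{dist}_G(u,v)\le 2$. Write $\Lambda=\max\{1,\log\frac n{D'}\}$. Besides their own color and $C$, the nodes know only constant-factor estimates $\nu$ of $\log n$ and $\lambda$ of $\Lambda$, that is, integers $\nu,\lambda\ge 1$ such that, for a constant $a\ge 1$, $$\log n\le \nu\le a\max\{1,\log n\},\qquad \Lambda-a\le\lambda\le a\,\Lambda ,$$ and the number $T$ of iterations. Define, for $j\ge 0$, $BC_{3j}=\lambda+i$, where $(j \bmod \nu)\equiv 2^i \pmod{2^{i+1}}$ (and $i=0$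 if $j\bmod \nu=0$), $BC_{3j+1}=j\bmod\lambda$ and $BC_{3j+2}=j\bmod \nu$. **Algorithm (Network-Coded Multi-Message Broadcast, $T$ iterations).** The source $s$ has $k$ messages $m_1,\dots,m_k\in GF(2)^b$. Every node $u$ keeps a set $P_u$ of packets in $GF(2)^k\times GF(2)^b$; initially $P_s=\{(e_i,m_i): 1\le i\le k\}$, where $e_i$ is the $i$-th unit vector, and $P_u=\emptyset$ for $u\neq s$. For $i=1,\dots,T$ and for $cycle=1,\dots,C$ there is one communication round: each node $u$ with $c(u)\equiv cycle \pmod C$, independently of the others, with probability $2^{-BC_i}$ transmits $\bigoplus_{v\in S}v$ for a uniformly random subset $S\subseteq P_u$ and otherwise listens; all other nodes listen; every node that receives a packet adds it to its set. At the end each node $u$ decodes, by linear algebra over $GF(2)$, each $m_i$ as the unique $y$ with $(e_i,y)\in\mathrm{span}(P_u)$, if there is exactly one such $y$. The algorithm takes $C\cdot T$ rounds. **Lemma.** For all constants $\beta\ge 2$ and $a\ge1$ there is a constant $A>0$, depending only on $\beta$ and $a$, such that the following holds for every connected graph $G$, every layering of $G$ with source $s$ and depth $D'$ that is $C$-collision-free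 together with a coloring $c$, all $\nu,\lambda$ as above, every $k$, every message length $b$ and all $k$ messages at $s$. For every $$T\ \ge\ A\Bigl(D'\max\{1,\log\tfrac n{D'}\}+k\log n+\log^2 n\Bigr)$$ the algorithm with $T$ iterations delivers all $k$ messages to all nodes (every node decodes every message correctly) with probability at least $1-n^{-\beta}$. In particular, $C\cdot O\bigl(D'\max\{1,\log\frac n{D'}\}+k\log n+\log^2 n\bigr)$ rounds suffice with high probability. (For $D'=0$, which happens only for $n=1$, the term $D'\max\{1,\log\frac n{D'}\}$ is $0$.) -/

import Mathlib

open scoped ENNReal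

namespace RadioNC

/-! ### Layerings -/

section Layering

variable {V : Type*}

/-- A layering of `G` with source `s`: an integer layer number for every node, such that `s` is the
only node of layer `0` and every other node has a neighbour with a smaller layer number. -/
structure IsLayering (G : SimpleGraph V) (s : V) (layer : V → ℤ) : Prop where
  source_iff : ∀ u, layer u = 0 ↔ u = s
  exists_lower : ∀ u, u ≠ s → ∃ v, G.Adj u v ∧ layer v < layer u

/-- `D` is the depth, that is, the largest layer number. -/
def HasDepth (layer : V → ℤ) (D : ℕ) : Prop :=
  IsGreatest (Set.range layer) (D : ℤ)

/-- Two nodes on different layers and at distance at most `2` have different colors. -/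
def CollisionFree (G : SimpleGraph V) (layer : V → ℤ) {C : ℕ} (color : V → Fin C) : Prop :=
  ∀ u v, layer u ≠ layer v → G.edist u v ≤ 2 → color u ≠ color v

end Layering

/-! ### The broadcast sequence -/

/-- The sequence `BC`, where `lam` stands for `log (n / D)` and `nu` for `log n`:
`BC (3j) = lam + i` where `j mod nu ≡ 2 ^ i (mod 2 ^ (i + 1))`, that is, `i` is the exponent of `2`
in `j mod nu` (and `i = 0` if `j mod nu = 0`),
`BC (3j + 1) = j mod lam` and `BC (3j + 2) = j mod nu`. -/
def bcSeq (lam nu t : ℕ) : ℕ :=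
  if t % 3 = 0 then lam + padicValNat 2 (t / 3 % nu)
  else if t % 3 = 1 then t / 3 % lam
  else t / 3 % nu

/-! ### Packets -/

/-- A message is a vector of `m` bits. -/
abbrev Message (m : ℕ) : Type := Fin m → ZMod 2

/-- A packet is a coefficient vector in `GF(2)^k` followed by `m` bits; addition is bitwise XOR. -/
abbrev Packet (k m : ℕ) : Type := (Fin k → ZMod 2) × Message m

/-- The packet `(e_i, m_i)` that belongs to the `i`-th message. -/
def basisPacket {k m : ℕ} (msg : Fin k → Message m) (i : Fin k) : Packet k m :=
  (Pi.single i 1, msg i)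

/-- What a node extracts about the `i`-th message from its set `P` of packets: the unique `y`
for which `(e_i, y)` lies in the span of `P`, if there is one. -/
noncomputable def decode {k m : ℕ} (P : Finset (Packet k m)) (i : Fin k) : Option (Message m) :=
  open Classical in
  if h : ∃! y : Message m,
      ((Pi.single i 1, y) : Packet k m) ∈ Submodule.span (ZMod 2) (P : Set (Packet k m))
  then some h.choose else none

/-! ### Randomness -/

/-- The joint law of independent choices `a v`, one for each `v`, with `a v` distributed
according to `p v`. -/
noncomputable def independent {V α : Type*} [Fintype V] [Fintype α] (p : V → PMF α) :
    PMF (V → α) :=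
  open Classical in
  PMF.ofFintype (fun a => ∏ v, p v (a v)) (by
    classical
    have h : ∀ v, ∑ x, p v x = 1 := fun v => by
      rw [← tsum_fintype (L := .unconditional _)]; exact (p v).tsum_coe
    rw [← Fintype.piFinset_univ, Finset.sum_prod_piFinset Finset.univ (fun v x => p v x)]
    simp [h])

/-- A coin that shows `true` with probability `2 ^ (-b)`. -/
noncomputable def coin (b : ℕ) : PMF Bool :=
  PMF.ofFintype (fun x => cond x ((2 : ℝ≥0∞) ^ b)⁻¹ (1 - ((2 : ℝ≥0∞) ^ b)⁻¹)) (by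
    have h : ((2 : ℝ≥0∞) ^ b)⁻¹ ≤ 1 := ENNReal.inv_le_one.2 (one_le_pow₀ (by norm_num))
    simp [h])

/-! ### The radio network and the algorithm -/

section Network

variable {V : Type*} [Fintype V] {k m : ℕ}

/-- In a round in which node `u` transmits the packet `x` if `act u = some x`, and listens if
`act u = none`, node `v` receives the packet `x`: node `v` listens, and exactly one of its
neighbours transmits, namely the packet `x`. -/
def Receives {α : Type*} (G : SimpleGraph V) (act : V → Option α) (v : V) (x : α) : Prop :=
  act v = none ∧ ∃ u, G.Adj v u ∧ act u = some x ∧ ∀ w, G.Adj v w → act w ≠ none → w = u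

/-- The sets of packets of all nodes at the start. -/
noncomputable def initialBuffers (s : V) (msg : Fin k → Message m) : V → Finset (Packet k m) :=
  open Classical in
  fun u => if u = s then Finset.univ.image (basisPacket msg) else ∅

/-- The random action of a node with set of packets `P` that is prompted with exponent `b`: with
probability `2 ^ (-b)` it transmits the sum of a uniformly random subset of `P`, and otherwise it
listens. -/
noncomputable def promptedAction (b : ℕ) (P : Finset (Packet k m)) :
    PMF (Option (Packet k m)) :=
  (coin b).bind fun x =>
    if x then
      (PMF.uniformOfFinset P.powerset ⟨∅, Finset.empty_mem_powerset P⟩).map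
        fun S => some (∑ v ∈ S, v)
    else PMF.pure none

/-- The random action of a node of color `c` with set of packets `P`, in cycle `cyc` of
iteration `i`. -/
noncomputable def nodeAction (lam nu C : ℕ) (i cyc : ℕ) (c : Fin C) (P : Finset (Packet k m)) :
    PMF (Option (Packet k m)) :=
  if cyc ≡ (c : ℕ) [MOD C] then promptedAction (bcSeq lam nu i) P else PMF.pure none

/-- Every node adds the packet that it receives, if any, to its set of packets. -/
noncomputable def updateBuffers (G : SimpleGraph V) (P : V → Finset (Packet k m))
    (act : V → Option (Packet k m)) : V → Finset (Packet k m) :=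
  open Classical in
  fun v => P v ∪ Finset.univ.filter fun x => Receives G act v x

/-- One communication round: cycle `cyc` of iteration `i`. All nodes make their random choices
independently. -/
noncomputable def step (G : SimpleGraph V) {C : ℕ} (color : V → Fin C) (lam nu i cyc : ℕ)
    (P : V → Finset (Packet k m)) : PMF (V → Finset (Packet k m)) :=
  (independent fun u => nodeAction lam nu C i cyc (color u) (P u)).map (updateBuffers G P)

/-- The law of the sets of packets after the first `r` communication rounds of the algorithm.
The iterations `1, 2, 3, …` consist of the cycles `1, …, C`, and each cycle is one round; so round
number `r` (counted from `0`) is cycle `r % C + 1` of iteration `r / C + 1`. -/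
noncomputable def run (G : SimpleGraph V) {C : ℕ} (color : V → Fin C) (lam nu : ℕ) (s : V)
    (msg : Fin k → Message m) : ℕ → PMF (V → Finset (Packet k m))
  | 0 => PMF.pure (initialBuffers s msg)
  | r + 1 => (run G color lam nu s msg r).bind
      (step G color lam nu (r / C + 1) (r % C + 1))

/-- Every node decodes all messages correctly. -/
def AllDelivered (msg : Fin k → Message m) (P : V → Finset (Packet k m)) : Prop :=
  ∀ u i, decode (P u) i = some (msg i)

/-- The probability that every node decodes all messages correctly when the algorithm ends after
`T` iterations, that is, after `C * T` communication rounds. -/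
noncomputable def successProb (G : SimpleGraph V) {C : ℕ} (color : V → Fin C) (lam nu : ℕ) (s : V)
    (msg : Fin k → Message m) (T : ℕ) : ℝ :=
  ((run G color lam nu s msg (C * T)).toOuterMeasure {P | AllDelivered msg P}).toReal

end Network

/-- `log (n / D)` to base `2`, where, as usual in such a bound, a logarithm below `1`
counts as `1`. -/
noncomputable def logRatio (n D : ℕ) : ℝ := max 1 (Real.logb 2 ((n : ℝ) / (D : ℝ)))

/-- `D log (n / D) + k log n + log² n`. -/
noncomputable def iterationBound (n D k : ℕ) : ℝ :=
  D * logRatio n D + k * Real.logb 2 n + Real.logb 2 n ^ 2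

end RadioNC

/-!
The proof reduces the delivery of `k` messages to the spreading of single directions. A node knows a
direction `μ ≠ 0` in `GF(2)^k` if one of its packets has a coefficient vector that is not orthogonal
to `μ` (`Knows`). All packets are consistent with the messages, so a node that knows all directions
has coefficient vectors of full rank and decodes correctly (`decode_eq_some`). It therefore suffices
that, for each `μ` and each node, the probability `f` of not knowing `μ` is at most
`2 ^ (-k) * n ^ (-β - 1)` at the end.

Fix `μ`, and let every node `v` other than the source single out the color of one neighbour on a
lower layer. By collision-freeness all neighbours of `v` with that color, the senders of `v`, are on
one lower layer, and `v` listens when they are prompted. If there are `d` senders and the exponent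
of the iteration is `⌊log d⌋`, then each sender is the only one to transmit with probability of
order `1 / d`, and if it knows `μ`, then half of its random linear combinations are not orthogonal
to `μ`. Hence `f` at `v` becomes at most a convex combination of the previous value at `v` and, with
total weight `1 / 32`, the average of the previous values at the senders (`ignorance_succ_le`).
This recursion for probabilities is linear: it does not matter how many senders know `μ`, nor how
their states are correlated.

The broadcast sequence offers the exponent `⌊log d⌋` within `O(lam + d / 2 ^ lam)` iterations, and
always within `O(max lam nu)` iterations (`exists_bcSeq_eq_in_window`). As the senders of `v` fit
into one layer, the waiting times along any descending path add up to at most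
`O(∑ (lam + d D / n))` over the layers, where `d` is now the size of the layer, and this is
`O(D * logRatio n D)` since the layers are disjoint (`layerPotential_le`). An exponential potential
argument (`le_exp_of_hitting`) turns the recursion into the bound `exp (θ (W - T))`, where `W` is
this sum and `1 / θ` is of order `max lam nu = O(log n)`. For the stated `T` this is small enough for
the union bound over the `2 ^ k` directions and `n` nodes.
-/

namespace RadioNC

/-! ### Coefficient vectors seen by a node -/

section Knows

variable {k m : ℕ}

/-- A set of packets knows the direction `μ` if some coefficient vector in it is not orthogonal
to `μ`. -/
def Knows (μ : Fin k → ZMod 2) (P : Finset (Packet k m)) : Prop :=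
  ∃ x ∈ P, μ ⬝ᵥ x.1 ≠ 0

theorem Knows.mono {μ : Fin k → ZMod 2} {P Q : Finset (Packet k m)} (hPQ : P ⊆ Q)
    (h : Knows μ P) : Knows μ Q := by
  obtain ⟨x, hx, hμ⟩ := h
  exact ⟨x, hPQ hx, hμ⟩

/-- A packet is consistent if its second part is the combination of the messages that its
coefficient vector announces. -/
def Consistent (msg : Fin k → Message m) (x : Packet k m) : Prop :=
  x.2 = ∑ i, x.1 i • msg i

/-- The consistent packets form a subspace. -/
def consistentSubmodule (msg : Fin k → Message m) : Submodule (ZMod 2) (Packet k m) where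
  carrier := {x | Consistent msg x}
  zero_mem' := by simp [Consistent]
  add_mem' := by
    intro x y hx hy
    simp only [Set.mem_ofPred_eq, Consistent] at *
    simp [hx, hy, add_smul, Finset.sum_add_distrib]
  smul_mem' := by
    intro c x hx
    simp only [Set.mem_ofPred_eq, Consistent] at *
    simp [hx, mul_smul, Finset.smul_sum]

/-- A subspace of coefficient vectors is proper only if some nonzero `μ` is orthogonal to it, so a
node that knows every direction has coefficient vectors of full rank; consistency then turns
Gaussian elimination into the correct messages. -/
theorem decode_eq_some {msg : Fin k → Message m} {P : Finset (Packet k m)}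
    (hcons : ∀ x ∈ P, Consistent msg x) (hknows : ∀ μ : Fin k → ZMod 2, μ ≠ 0 → Knows μ P)
    (i : Fin k) : decode P i = some (msg i) := by
  classical
  set S := Submodule.span (ZMod 2) (P : Set (Packet k m)) with hS
  have hle : S ≤ consistentSubmodule msg := Submodule.span_le.2 fun x hx => hcons x hx
  have hval : ∀ y, ((Pi.single i 1, y) : Packet k m) ∈ S → y = msg i := by
    intro y hy
    have h : y = ∑ j, (Pi.single i 1 : Fin k → ZMod 2) j • msg j := hle hy
    rw [h, Finset.sum_eq_single i]
    · simp
    · intro j _ hj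
      simp [hj]
    · simp
  have htop : S.map (LinearMap.fst (ZMod 2) (Fin k → ZMod 2) (Message m)) = ⊤ := by
    by_contra hne
    obtain ⟨f, hf, hfS⟩ := Submodule.exists_le_ker_of_lt_top _ (lt_top_iff_ne_top.2 hne)
    have hdot : ∀ x, f x = (fun j => f (Pi.single j 1)) ⬝ᵥ x := by
      intro x
      rw [LinearMap.pi_apply_eq_sum_univ f x]
      refine Finset.sum_congr rfl fun j _ => ?_
      rw [smul_eq_mul, mul_comm]
      congr 2
      ext l
      simp [Pi.single_apply, eq_comm]
    obtain ⟨x, hx, hxμ⟩ := hknows (fun j => f (Pi.single j 1)) (by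
      intro h0
      exact hf (LinearMap.ext fun x => by rw [hdot, h0]; simp))
    rw [← hdot] at hxμ
    exact hxμ (hfS (Submodule.mem_map_of_mem (f := LinearMap.fst _ _ _)
      (Submodule.subset_span hx)))
  have hmem : ((Pi.single i 1, msg i) : Packet k m) ∈ S := by
    have h : (Pi.single i 1 : Fin k → ZMod 2) ∈
        S.map (LinearMap.fst (ZMod 2) (Fin k → ZMod 2) (Message m)) := htop ▸ Submodule.mem_top
    obtain ⟨⟨z, y⟩, hz, hz1⟩ := h
    simp only [LinearMap.fst_apply] at hz1
    subst hz1
    rwa [← hval y hz]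
  have hex : ∃! y : Message m, ((Pi.single i 1, y) : Packet k m) ∈ S := ⟨msg i, hmem, hval⟩
  unfold decode
  rw [dif_pos hex]
  exact congrArg some (hval _ hex.choose_spec.1)

open Classical in
/-- At least half of the subsets of a set that knows `μ` have a sum that is not orthogonal to `μ`:
toggling one fixed element not orthogonal to `μ` flips the inner product of the sum with `μ`. -/
theorem card_powerset_le_two_mul_card_filter {μ : Fin k → ZMod 2} {P : Finset (Packet k m)}
    (h : Knows μ P) :
    P.powerset.card ≤ 2 * (P.powerset.filter fun S => μ ⬝ᵥ (∑ x ∈ S, x).1 ≠ 0).card := by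
  obtain ⟨x, hx, hμ⟩ := h
  have hflip : (P.powerset.filter fun S => ¬ μ ⬝ᵥ (∑ x ∈ S, x).1 ≠ 0).card ≤
      (P.powerset.filter fun S => μ ⬝ᵥ (∑ x ∈ S, x).1 ≠ 0).card := by
    refine Finset.card_le_card_of_injOn (fun S => symmDiff S {x}) ?_
      (fun S _ S' _ hSS => symmDiff_left_injective _ hSS)
    intro S hS
    simp only [Finset.coe_filter, Finset.mem_powerset, Set.mem_ofPred_eq, not_not, Prod.fst_sum]
      at hS ⊢
    obtain ⟨hSP, hS0⟩ := hS
    by_cases hxS : x ∈ S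
    · have hsd : symmDiff S {x} = S.erase x := by
        ext y
        by_cases hy : y = x <;> simp [Finset.mem_symmDiff, hy, hxS]
      rw [hsd]
      refine ⟨(Finset.erase_subset _ _).trans hSP, fun h0 => hμ ?_⟩
      rw [← Finset.add_sum_erase S _ hxS, dotProduct_add, h0, add_zero] at hS0
      exact hS0
    · have hsd : symmDiff S {x} = insert x S := by
        ext y
        by_cases hy : y = x <;> simp [Finset.mem_symmDiff, hy, hxS]
      rw [hsd]
      refine ⟨Finset.insert_subset hx hSP, ?_⟩
      rw [Finset.sum_insert hxS, dotProduct_add, hS0, add_zero]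
      exact hμ
  have hsum := Finset.card_filter_add_card_filter_not (s := P.powerset)
    (fun S => μ ⬝ᵥ (∑ x ∈ S, x).1 ≠ 0)
  omega

end Knows

/-! ### Probabilities of actions -/

section Actions

theorem toOuterMeasure_independent_pi {V α : Type*} [Fintype V] [Fintype α] (p : V → PMF α)
    (A : V → Set α) :
    (independent p).toOuterMeasure {a | ∀ v, a v ∈ A v} = ∏ v, (p v).toOuterMeasure (A v) := by
  classical
  have h : ∀ v, (p v).toOuterMeasure (A v) = ∑ x ∈ Finset.univ.filter (· ∈ A v), p v x := by
    intro v
    rw [PMF.toOuterMeasure_apply_fintype, Finset.sum_filter]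
    simp [Set.indicator_apply]
  simp_rw [h]
  rw [Finset.prod_univ_sum, PMF.toOuterMeasure_apply_fintype]
  rw [← Finset.sum_subset (Finset.subset_univ
    (Fintype.piFinset fun v => Finset.univ.filter (· ∈ A v)))]
  · refine Finset.sum_congr rfl fun a ha => ?_
    rw [Set.indicator_of_mem]
    · simp [independent]
    · simpa [Fintype.mem_piFinset] using ha
  · intro a _ ha
    rw [Set.indicator_of_notMem]
    simpa [Fintype.mem_piFinset] using ha

variable {k m : ℕ}

theorem promptedAction_toOuterMeasure_none (b : ℕ) (P : Finset (Packet k m)) :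
    (promptedAction b P).toOuterMeasure {none} = 1 - ((2 : ℝ≥0∞) ^ b)⁻¹ := by
  rw [promptedAction, PMF.toOuterMeasure_bind_apply, tsum_fintype]
  simp [coin]

/-- A prompted node that knows `μ` transmits a packet not orthogonal to `μ` at least half of the
times that it transmits at all. -/
theorem le_promptedAction_toOuterMeasure {μ : Fin k → ZMod 2} {P : Finset (Packet k m)}
    (h : Knows μ P) (b : ℕ) :
    ((2 : ℝ≥0∞) ^ b)⁻¹ * 2⁻¹ ≤
      (promptedAction b P).toOuterMeasure {o | ∃ x, o = some x ∧ μ ⬝ᵥ x.1 ≠ 0} := by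
  classical
  rw [promptedAction, PMF.toOuterMeasure_bind_apply, tsum_fintype]
  simp only [Fintype.sum_bool, if_true]
  refine le_add_right ?_
  have h1 : coin b true = ((2 : ℝ≥0∞) ^ b)⁻¹ := by simp [coin]
  rw [h1]
  gcongr
  rw [PMF.toOuterMeasure_map_apply]
  refine le_trans ?_ (PMF.toOuterMeasure_uniformOfFinset_apply (s := P.powerset)
    ⟨∅, Finset.empty_mem_powerset P⟩ _).ge
  have hcard := card_powerset_le_two_mul_card_filter h
  have hset : (P.powerset.filter fun S => S ∈
      (fun S : Finset (Packet k m) => some (∑ v ∈ S, v)) ⁻¹'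
        {o : Option (Packet k m) | ∃ x, o = some x ∧ μ ⬝ᵥ x.1 ≠ 0}) =
      P.powerset.filter fun S => μ ⬝ᵥ (∑ x ∈ S, x).1 ≠ 0 := by
    ext S
    simp only [Finset.mem_filter, Set.mem_preimage, Set.mem_ofPred_eq, Option.some.injEq,
      exists_eq_left']
  rw [hset, ENNReal.le_div_iff_mul_le (Or.inl (by simp)) (Or.inl (by simp)), mul_comm,
    ← div_eq_mul_inv]
  refine ENNReal.div_le_of_le_mul ?_
  rw [mul_comm]
  exact_mod_cast hcard

/-- With `2 ^ b ≤ d < 2 ^ (b + 1)`, exactly one of `d` senders of transmission probability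
`2 ^ (-b)` transmits with probability at least `1 / 16`; each of the `d` possible transmitters gets
an equal share, and a factor `1 / 2` accounts for the random linear combination. -/
theorem inv_le_transmission_prob {b d : ℕ} (h1 : 2 ^ b ≤ d) (h2 : d < 2 ^ (b + 1)) :
    ((32 * d : ℕ) : ℝ≥0∞)⁻¹ ≤
      ((2 : ℝ≥0∞) ^ b)⁻¹ * 2⁻¹ * (1 - ((2 : ℝ≥0∞) ^ b)⁻¹) ^ (d - 1) := by
  have hd : 0 < d := lt_of_lt_of_le (by positivity) h1
  have hd' : (0 : ℝ) < d := by exact_mod_cast hd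
  have hp0 : (0 : ℝ) < (2 ^ b)⁻¹ := by positivity
  have hp1 : ((2 : ℝ) ^ b)⁻¹ ≤ 1 := inv_le_one_of_one_le₀ (one_le_pow₀ (by norm_num))
  have hpow : (1 / 16 : ℝ) ≤ (1 - (2 ^ b)⁻¹) ^ (d - 1) := by
    rcases Nat.eq_zero_or_pos b with rfl | hb
    · have : d = 1 := by simp at h1 h2; omega
      subst this
      norm_num
    · obtain ⟨c, rfl⟩ : ∃ c, b = c + 1 := ⟨b - 1, by omega⟩
      -- Bernoulli's inequality up to exponent `2 ^ c`, then two squarings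
      have hb1 := one_add_mul_le_pow (a := -((2 : ℝ) ^ (c + 1))⁻¹) (by linarith) (2 ^ c)
      have hb2 : (1 / 2 : ℝ) ≤ (1 - (2 ^ (c + 1))⁻¹) ^ (2 ^ c) := by
        refine le_trans (le_of_eq ?_) (hb1.trans (le_of_eq ?_))
        · push_cast
          rw [pow_succ]
          field_simp
          norm_num
        · rw [← sub_eq_add_neg]
      calc (1 / 16 : ℝ) = (1 / 2) ^ 4 := by norm_num
        _ ≤ ((1 - (2 ^ (c + 1))⁻¹) ^ (2 ^ c)) ^ 4 := by gcongr
        _ = (1 - (2 ^ (c + 1))⁻¹) ^ (2 ^ c * 4) := by rw [pow_mul]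
        _ ≤ (1 - (2 ^ (c + 1))⁻¹) ^ (d - 1) := by
          refine pow_le_pow_of_le_one (by linarith) (by linarith) ?_
          have : 2 ^ (c + 1 + 1) = 2 ^ c * 4 := by ring
          omega
  have hreal : ((32 * d : ℕ) : ℝ)⁻¹ ≤ (2 ^ b)⁻¹ * 2⁻¹ * (1 - (2 ^ b)⁻¹) ^ (d - 1) := by
    have hbd : ((d : ℝ))⁻¹ ≤ ((2 : ℝ) ^ b)⁻¹ :=
      inv_anti₀ (by positivity) (by exact_mod_cast h1)
    calc ((32 * d : ℕ) : ℝ)⁻¹ = (d : ℝ)⁻¹ * 2⁻¹ * (1 / 16) := by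
          push_cast; rw [mul_inv]; ring
      _ ≤ _ := by gcongr
  have htwo : ((2 : ℝ≥0∞) ^ b)⁻¹ = ENNReal.ofReal ((2 ^ b)⁻¹) := by
    rw [ENNReal.ofReal_inv_of_pos (by positivity), ENNReal.ofReal_pow (by norm_num)]
    simp
  have hhalf : (2 : ℝ≥0∞)⁻¹ = ENNReal.ofReal 2⁻¹ := by
    rw [ENNReal.ofReal_inv_of_pos (by norm_num)]
    simp
  have hd32 : ((32 * d : ℕ) : ℝ≥0∞)⁻¹ = ENNReal.ofReal (((32 * d : ℕ) : ℝ)⁻¹) := by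
    rw [ENNReal.ofReal_inv_of_pos (by exact_mod_cast (by omega : 0 < 32 * d)),
      ENNReal.ofReal_natCast]
  have hone : 1 - ENNReal.ofReal ((2 ^ b)⁻¹) = ENNReal.ofReal (1 - (2 ^ b)⁻¹) := by
    rw [ENNReal.ofReal_sub _ hp0.le, ENNReal.ofReal_one]
  rw [hd32, htwo, hhalf, hone, ← ENNReal.ofReal_pow (by linarith),
    ← ENNReal.ofReal_mul hp0.le, ← ENNReal.ofReal_mul (by positivity)]
  exact ENNReal.ofReal_le_ofReal hreal

end Actions

/-! ### One communication round -/

section Round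

variable {V : Type*} {k m : ℕ}

theorem toOuterMeasure_univ {α : Type*} (p : PMF α) : p.toOuterMeasure Set.univ = 1 :=
  (PMF.toOuterMeasure_apply_eq_one_iff p _).2 (Set.subset_univ _)

theorem toOuterMeasure_le_one {α : Type*} (p : PMF α) (S : Set α) : p.toOuterMeasure S ≤ 1 :=
  (MeasureTheory.measure_mono (Set.subset_univ S)).trans (toOuterMeasure_univ p).le

theorem toOuterMeasure_add_sum_le_one {α ι : Type*} (p : PMF α) (B : Set α) (K : Finset ι)
    (E : ι → Set α) (hB : ∀ u ∈ K, Disjoint B (E u)) (hE : (K : Set ι).PairwiseDisjoint E) :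
    p.toOuterMeasure B + ∑ u ∈ K, p.toOuterMeasure (E u) ≤ 1 := by
  let _ : MeasurableSpace α := ⊤
  have hm : ∀ S : Set α, p.toOuterMeasure S = p.toMeasure S := fun S =>
    (p.toMeasure_apply_eq_toOuterMeasure_apply trivial).symm
  simp_rw [hm]
  rw [← MeasureTheory.measure_biUnion_finset hE fun _ _ => trivial,
    ← MeasureTheory.measure_union (Set.disjoint_iUnion₂_right.2 hB)
      (Finset.measurableSet_biUnion _ fun _ _ => trivial)]
  exact MeasureTheory.prob_le_one

theorem subset_updateBuffers (G : SimpleGraph V) (P : V → Finset (Packet k m))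
    (act : V → Option (Packet k m)) (v : V) : P v ⊆ updateBuffers G P act v :=
  Finset.subset_union_left

open Classical in
/-- The actions that node `w` may take in the event that `u` transmits a packet that is not
orthogonal to `μ`, while `v` and all other neighbours of `v` listen. The event is a product of
conditions on single nodes. -/
def deliverySet (G : SimpleGraph V) (μ : Fin k → ZMod 2) (v u w : V) :
    Set (Option (Packet k m)) :=
  if w = u then {o | ∃ x, o = some x ∧ μ ⬝ᵥ x.1 ≠ 0}
  else if w = v ∨ G.Adj v w then {none} else Set.univ

theorem knows_updateBuffers {G : SimpleGraph V} {μ : Fin k → ZMod 2} {v u : V}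
    (huv : G.Adj v u) {P : V → Finset (Packet k m)} {act : V → Option (Packet k m)}
    (h : ∀ w, act w ∈ deliverySet G μ v u w) : Knows μ (updateBuffers G P act v) := by
  have hu := h u
  simp only [deliverySet, if_true, Set.mem_ofPred_eq] at hu
  obtain ⟨x, hx, hμ⟩ := hu
  have hv := h v
  rw [deliverySet, if_neg huv.ne, if_pos (Or.inl rfl)] at hv
  have hrec : Receives G act v x := by
    refine ⟨hv, u, huv, hx, fun w hw hact => ?_⟩
    by_contra hne
    have hw' := h w
    rw [deliverySet, if_neg hne, if_pos (Or.inr hw)] at hw'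
    exact hact hw'
  exact ⟨x, by simp [updateBuffers, hrec], hμ⟩

variable [Fintype V]

open Classical in
/-- The neighbours of `v` that have color `c`. -/
noncomputable def senders (G : SimpleGraph V) {C : ℕ} (color : V → Fin C) (v : V) (c : Fin C) :
    Finset V :=
  Finset.univ.filter fun u => G.Adj v u ∧ color u = c

theorem mem_senders {G : SimpleGraph V} {C : ℕ} {color : V → Fin C} {v u : V} {c : Fin C} :
    u ∈ senders G color v c ↔ G.Adj v u ∧ color u = c := by
  simp [senders]

/-- In the round of color `c`, every sender that knows `μ` has a chance of at least `1 / (32 d)`,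
where `d` is the number of senders, to be the one that delivers to `v` a packet not orthogonal
to `μ`. -/
theorem le_independent_deliverySet {G : SimpleGraph V} {C : ℕ} {color : V → Fin C} {v u : V}
    {c : Fin C} (hu : u ∈ senders G color v c) (hvc : color v ≠ c) {μ : Fin k → ZMod 2}
    {P : V → Finset (Packet k m)} (hK : Knows μ (P u)) {lam nu i cyc : ℕ}
    (hcyc : cyc ≡ c [MOD C]) (h1 : 2 ^ bcSeq lam nu i ≤ (senders G color v c).card)
    (h2 : (senders G color v c).card < 2 ^ (bcSeq lam nu i + 1)) :
    ((32 * (senders G color v c).card : ℕ) : ℝ≥0∞)⁻¹ ≤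
      (independent fun w => nodeAction lam nu C i cyc (color w) (P w)).toOuterMeasure
        {a | ∀ w, a w ∈ deliverySet G μ v u w} := by
  classical
  rw [toOuterMeasure_independent_pi]
  refine (inv_le_transmission_prob h1 h2).trans ?_
  set b := bcSeq lam nu i
  set U := senders G color v c
  set h : V → ℝ≥0∞ := fun w =>
    if w = u then ((2 : ℝ≥0∞) ^ b)⁻¹ * 2⁻¹ else if w ∈ U then 1 - ((2 : ℝ≥0∞) ^ b)⁻¹ else 1
    with hh
  have hprod : ∏ w, h w = ((2 : ℝ≥0∞) ^ b)⁻¹ * 2⁻¹ * (1 - ((2 : ℝ≥0∞) ^ b)⁻¹) ^ (U.card - 1) := by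
    rw [← Finset.prod_subset (Finset.subset_univ U), ← Finset.mul_prod_erase U h hu,
      Finset.prod_congr rfl (g := fun _ => 1 - ((2 : ℝ≥0∞) ^ b)⁻¹), Finset.prod_const,
      Finset.card_erase_of_mem hu]
    · simp [hh]
    · intro w hw
      simp [hh, Finset.ne_of_mem_erase hw, Finset.mem_of_mem_erase hw]
    · intro w _ hw
      have hne : w ≠ u := fun h => hw (h ▸ hu)
      simp [hh, hne, hw]
  rw [← hprod]
  refine Finset.prod_le_prod' fun w _ => ?_
  obtain ⟨-, huc⟩ := mem_senders.1 hu
  have hact : ∀ w, color w = c → nodeAction lam nu C i cyc (color w) (P w) =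
      promptedAction b (P w) := by
    intro w hw
    rw [nodeAction, if_pos (by rw [hw]; exact hcyc)]
  by_cases hwu : w = u
  · subst hwu
    simp only [hh, deliverySet, if_true, hact w huc]
    exact le_promptedAction_toOuterMeasure hK b
  by_cases hwU : w ∈ U
  · obtain ⟨hvw, hwc⟩ := mem_senders.1 hwU
    simp only [hh, deliverySet, if_neg hwu, if_pos hwU, hvw, or_true, if_true, hact w hwc]
    exact (promptedAction_toOuterMeasure_none b (P w)).ge
  · simp only [hh, deliverySet, if_neg hwu, if_neg hwU]
    split_ifs with hvw
    · have hwc : color w ≠ c := by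
        rcases hvw with rfl | hvw
        · exact hvc
        · exact fun hwc => hwU (mem_senders.2 ⟨hvw, hwc⟩)
      have hnot : ¬ cyc ≡ (color w : ℕ) [MOD C] := by
        intro hmod
        have := hmod.symm.trans hcyc
        exact hwc (Fin.ext (Nat.ModEq.eq_of_lt_of_lt this (color w).2 c.2))
      rw [nodeAction, if_neg hnot]
      simp
    · exact (toOuterMeasure_univ _).ge

open Classical in
/-- The chance that an ignorant node stays ignorant, and the chances of being taught by the
different senders, belong to disjoint events. -/
theorem step_toOuterMeasure_add_le_one {G : SimpleGraph V} {C : ℕ} {color : V → Fin C} {v : V}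
    {c : Fin C} (hvc : color v ≠ c) (μ : Fin k → ZMod 2)
    (P : V → Finset (Packet k m)) {lam nu i cyc : ℕ}
    (hcyc : cyc ≡ c [MOD C]) (h1 : 2 ^ bcSeq lam nu i ≤ (senders G color v c).card)
    (h2 : (senders G color v c).card < 2 ^ (bcSeq lam nu i + 1)) :
    (step G color lam nu i cyc P).toOuterMeasure {Q | ¬ Knows μ (Q v)} +
      ∑ _u ∈ (senders G color v c).filter (fun u => Knows μ (P u)),
        ((32 * (senders G color v c).card : ℕ) : ℝ≥0∞)⁻¹ ≤ 1 := by
  refine le_trans ?_ (toOuterMeasure_add_sum_le_one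
    (independent fun w => nodeAction lam nu C i cyc (color w) (P w))
    {a | ¬ Knows μ (updateBuffers G P a v)}
    ((senders G color v c).filter (fun u => Knows μ (P u)))
    (fun u => {a | ∀ w, a w ∈ deliverySet G μ v u w}) ?_ ?_)
  · rw [step, PMF.toOuterMeasure_map_apply]
    gcongr with u hu
    · exact le_rfl
    · obtain ⟨huU, hK⟩ := Finset.mem_filter.1 hu
      exact le_independent_deliverySet huU hvc hK hcyc h1 h2
  · intro u hu
    refine Set.disjoint_left.2 fun a ha hau => ha ?_
    exact knows_updateBuffers (mem_senders.1 (Finset.mem_filter.1 hu).1).1 hau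
  · intro u hu u' hu' hne
    refine Set.disjoint_left.2 fun a ha ha' => ?_
    have h1 := ha u
    have h2 := ha' u
    rw [deliverySet, if_pos rfl] at h1
    rw [deliverySet, if_neg hne,
      if_pos (Or.inr (mem_senders.1 (Finset.mem_filter.1 hu).1).1)] at h2
    obtain ⟨x, hx, -⟩ := h1
    rw [Set.mem_singleton_iff.1 h2] at hx
    cases hx

/-- The probability that node `v` does not know `μ` after `r` rounds. -/
noncomputable def ignorance (G : SimpleGraph V) {C : ℕ} (color : V → Fin C) (lam nu : ℕ) (s : V)
    (msg : Fin k → Message m) (μ : Fin k → ZMod 2) (r : ℕ) (v : V) : ℝ≥0∞ :=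
  (run G color lam nu s msg r).toOuterMeasure {P | ¬ Knows μ (P v)}

theorem toOuterMeasure_bind_le {α γ : Type*} (p : PMF α) (f : α → PMF γ) (S : Set γ)
    (g : α → ℝ≥0∞) (h : ∀ x, (f x).toOuterMeasure S ≤ g x) :
    (p.bind f).toOuterMeasure S ≤ ∑' x, p x * g x := by
  rw [PMF.toOuterMeasure_bind_apply]
  exact ENNReal.tsum_le_tsum fun x => by gcongr; exact h x

theorem tsum_mul_indicator {α : Type*} (p : PMF α) (S : Set α) :
    ∑' x, p x * S.indicator 1 x = p.toOuterMeasure S := by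
  rw [PMF.toOuterMeasure_apply]
  refine tsum_congr fun x => ?_
  by_cases hx : x ∈ S <;> simp [hx]

theorem step_toOuterMeasure_eq_zero (G : SimpleGraph V) {C : ℕ} (color : V → Fin C)
    (lam nu i cyc : ℕ) {μ : Fin k → ZMod 2} {P : V → Finset (Packet k m)} {v : V}
    (h : Knows μ (P v)) :
    (step G color lam nu i cyc P).toOuterMeasure {Q | ¬ Knows μ (Q v)} = 0 := by
  have he : updateBuffers G P ⁻¹' {Q | ¬ Knows μ (Q v)} = ∅ := by
    ext a
    simpa using h.mono (subset_updateBuffers G P a v)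
  rw [step, PMF.toOuterMeasure_map_apply, he]
  simp

variable (G : SimpleGraph V) {C : ℕ} (color : V → Fin C) (lam nu : ℕ) (s : V)
  (msg : Fin k → Message m) (μ : Fin k → ZMod 2)

theorem ignorance_le_one (r : ℕ) (v : V) : ignorance G color lam nu s msg μ r v ≤ 1 :=
  toOuterMeasure_le_one _ _

theorem ignorance_ne_top (r : ℕ) (v : V) : ignorance G color lam nu s msg μ r v ≠ ∞ :=
  ((ignorance_le_one G color lam nu s msg μ r v).trans_lt ENNReal.one_lt_top).ne

theorem ignorance_succ_le_self (r : ℕ) (v : V) :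
    ignorance G color lam nu s msg μ (r + 1) v ≤ ignorance G color lam nu s msg μ r v := by
  refine (toOuterMeasure_bind_le _ _ _ ({P | ¬ Knows μ (P v)}.indicator 1) fun P => ?_).trans
    (tsum_mul_indicator _ _).le
  by_cases h : Knows μ (P v)
  · rw [step_toOuterMeasure_eq_zero _ _ _ _ _ _ h]
    exact zero_le
  · rw [Set.indicator_of_mem (by exact h)]
    exact toOuterMeasure_le_one _ _

theorem antitone_ignorance (v : V) :
    Antitone fun r => ignorance G color lam nu s msg μ r v :=
  antitone_nat_of_succ_le fun r => ignorance_succ_le_self G color lam nu s msg μ r v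

theorem ignorance_source {μ : Fin k → ZMod 2} (hμ : μ ≠ 0) (r : ℕ) :
    ignorance G color lam nu s msg μ r s = 0 := by
  refine le_antisymm ((antitone_ignorance G color lam nu s msg μ s (Nat.zero_le r)).trans ?_)
    (zero_le)
  obtain ⟨i, hi⟩ := Function.ne_iff.1 hμ
  have hK : Knows μ (initialBuffers s msg s) :=
    ⟨basisPacket msg i, by simp [initialBuffers], by simpa [basisPacket] using hi⟩
  simp [ignorance, run, PMF.toOuterMeasure_pure_apply, hK]

theorem natCast_mul_inv_mul {d : ℕ} (hd : d ≠ 0) :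
    (d : ℝ≥0∞) * ((32 * d : ℕ) : ℝ≥0∞)⁻¹ = 32⁻¹ := by
  have hd0 : (d : ℝ≥0∞) ≠ 0 := by exact_mod_cast hd
  rw [Nat.cast_mul, ENNReal.mul_inv (Or.inl (by simp)) (Or.inl (by simp)), mul_comm, mul_assoc,
    ENNReal.inv_mul_cancel hd0 (ENNReal.natCast_ne_top _), mul_one]
  simp

/-- In a suitable round the ignorance of `v` moves by a fixed fraction towards the average
ignorance of its senders. The recursion is linear, so it can be unrolled although the states of
different nodes are correlated. -/
theorem ignorance_succ_le {v : V} {c : Fin C} (hvc : color v ≠ c) {r : ℕ}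
    (hcyc : r % C + 1 ≡ c [MOD C])
    (h1 : 2 ^ bcSeq lam nu (r / C + 1) ≤ (senders G color v c).card)
    (h2 : (senders G color v c).card < 2 ^ (bcSeq lam nu (r / C + 1) + 1)) :
    ignorance G color lam nu s msg μ (r + 1) v ≤
      (1 - 32⁻¹) * ignorance G color lam nu s msg μ r v +
      ∑ u ∈ senders G color v c, ((32 * (senders G color v c).card : ℕ) : ℝ≥0∞)⁻¹ *
        ignorance G color lam nu s msg μ r u := by
  classical
  set U := senders G color v c with hU
  set q : ℝ≥0∞ := ((32 * U.card : ℕ) : ℝ≥0∞)⁻¹ with hq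
  have hd : 0 < U.card := lt_of_lt_of_le (by positivity) h1
  have hqtop : q ≠ ∞ := ENNReal.inv_ne_top.2 (by exact_mod_cast (by omega : 32 * U.card ≠ 0))
  have hsum : ∑ _u ∈ U, q = 32⁻¹ := by
    rw [Finset.sum_const, nsmul_eq_mul, natCast_mul_inv_mul hd.ne']
  refine (toOuterMeasure_bind_le _ _ _ (fun P =>
    (1 - 32⁻¹) * {P : V → Finset (Packet k m) | ¬ Knows μ (P v)}.indicator 1 P +
      ∑ u ∈ U, q * {P : V → Finset (Packet k m) | ¬ Knows μ (P u)}.indicator 1 P)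
    fun P => ?_).trans (le_of_eq ?_)
  · by_cases h : Knows μ (P v)
    · rw [step_toOuterMeasure_eq_zero _ _ _ _ _ _ h]
      exact zero_le
    · have hstep := step_toOuterMeasure_add_le_one hvc μ P hcyc h1 h2
      rw [← hU, ← hq] at hstep
      have hone : (1 : ℝ≥0∞) = (1 - 32⁻¹) +
          ∑ u ∈ U, q * {P : V → Finset (Packet k m) | ¬ Knows μ (P u)}.indicator 1 P +
          ∑ u ∈ U.filter (fun u => Knows μ (P u)), q := by
        have hsplit : ∑ u ∈ U, q * {P : V → Finset (Packet k m) | ¬ Knows μ (P u)}.indicator 1 P +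
            ∑ u ∈ U.filter (fun u => Knows μ (P u)), q = 32⁻¹ := by
          rw [← hsum, Finset.sum_filter, ← Finset.sum_add_distrib]
          refine Finset.sum_congr rfl fun u _ => ?_
          by_cases hu : Knows μ (P u) <;> simp [hu]
        rw [add_assoc, hsplit, tsub_add_cancel_of_le]
        exact ENNReal.inv_le_one.2 (by norm_num)
      rw [hone] at hstep
      rw [Set.indicator_of_mem (by exact h), Pi.one_apply, mul_one]
      refine (ENNReal.add_le_add_iff_right ?_).1 hstep
      exact (ENNReal.sum_lt_top.2 fun _ _ => hqtop.lt_top).ne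
  · simp only [mul_add, Finset.mul_sum]
    rw [ENNReal.tsum_add, Summable.tsum_finsetSum fun _ _ => ENNReal.summable]
    simp only [mul_left_comm _ (1 - 32⁻¹ : ℝ≥0∞), mul_left_comm _ q, ENNReal.tsum_mul_left,
      tsum_mul_indicator]
    rfl

end Round

/-! ### Exponential decay along layers -/

/-- Tail bound for a process that moves towards the source: `f t v` plays the role of the
probability that node `v` is ignorant at time `t`, `U v` is the set of senders of `v`, and `w v` is
a number of steps within which `v` gets a chance of `1 / 32` to take over the state of a sender.
If the potential `W` grows by `129 * w v` from the senders of `v` to `v`, then `f` decays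
exponentially, at a rate `θ` inversely proportional to the largest `w v`, beyond time `W v`. -/
theorem le_exp_of_hitting {V : Type*} {f : ℕ → V → ℝ} {s : V} {U : V → Set V} {w : V → ℕ}
    {W : V → ℝ} {θ : ℝ} (hf1 : ∀ t v, f t v ≤ 1) (hfs : ∀ t, f t s ≤ 0) (hθ : 0 ≤ θ)
    (hw : ∀ v, v ≠ s → 1 ≤ w v)
    (hWU : ∀ v, v ≠ s → ∀ u ∈ U v, W u + 129 * w v ≤ W v)
    (hWw : ∀ v, v ≠ s → (w v : ℝ) ≤ W v)
    (hθw : ∀ v, v ≠ s → 128 * θ * w v ≤ 1)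
    (hhit : ∀ v, v ≠ s → ∀ t B, (∀ u ∈ U v, f t u ≤ B) →
      f (t + w v) v ≤ 31 / 32 * f t v + 1 / 32 * B) (t : ℕ) (v : V) :
    f t v ≤ Real.exp (θ * (W v - t)) := by
  induction t using Nat.strong_induction_on generalizing v with
  | _ t ih =>
    by_cases hvs : v = s
    · subst hvs
      exact (hfs t).trans (Real.exp_pos _).le
    rcases lt_or_ge t (w v) with ht | ht
    · refine (hf1 t v).trans (Real.one_le_exp (mul_nonneg hθ ?_))
      have : (t : ℝ) ≤ w v := by exact_mod_cast ht.le
      linarith [hWw v hvs]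
    · obtain ⟨t', rfl⟩ := Nat.exists_eq_add_of_le' ht
      have hlt : t' < t' + w v := by have := hw v hvs; omega
      set x : ℝ := θ * w v with hx
      have hx0 : 0 ≤ x := by positivity
      have hx1 : 128 * x ≤ 1 := by rw [hx, ← mul_assoc]; exact hθw v hvs
      set e := Real.exp (θ * (W v - (t' + w v : ℕ))) with he
      have hv : f t' v ≤ e * Real.exp x := by
        refine (ih t' hlt v).trans_eq ?_
        rw [he, ← Real.exp_add]
        congr 1
        push_cast
        rw [hx]
        ring
      -- `128 = 129 - 1`: a step to a sender lowers the potential by `129 w`, but costs `w` in time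
      have hu : ∀ u ∈ U v, f t' u ≤ e * Real.exp (-(128 * x)) := by
        intro u hu
        refine (ih t' hlt u).trans ?_
        rw [he, ← Real.exp_add, Real.exp_le_exp, hx]
        push_cast
        nlinarith [hWU v hvs u hu]
      have hexp1 : Real.exp x ≤ 1 + 2 * x := by
        have h1 := Real.add_one_le_exp (-x)
        have h2 : Real.exp x * Real.exp (-x) = 1 := by rw [← Real.exp_add]; simp
        nlinarith [Real.exp_pos x]
      have hexp2 : Real.exp (-(128 * x)) ≤ 1 - 64 * x := by
        have h1 := Real.add_one_le_exp (128 * x)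
        have h2 : Real.exp (128 * x) * Real.exp (-(128 * x)) = 1 := by
          rw [← Real.exp_add]; simp
        have h3 := Real.exp_pos (-(128 * x))
        -- `(1 + z) (1 - z / 2) ≥ 1` for `z = 128 x ∈ [0, 1]`
        have h4 : (1 + 128 * x) * Real.exp (-(128 * x)) ≤ 1 := by nlinarith
        have h5 : (1 : ℝ) ≤ (1 + 128 * x) * (1 - 64 * x) := by nlinarith
        by_contra! hcon
        nlinarith
      have he0 : 0 < e := Real.exp_pos _
      calc f (t' + w v) v ≤ 31 / 32 * f t' v + 1 / 32 * (e * Real.exp (-(128 * x))) :=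
            hhit v hvs t' _ hu
        _ ≤ 31 / 32 * (e * (1 + 2 * x)) + 1 / 32 * (e * (1 - 64 * x)) := by
            have := mul_le_mul_of_nonneg_left hexp1 he0.le
            have := mul_le_mul_of_nonneg_left hexp2 he0.le
            linarith
        _ ≤ e := by nlinarith

/-! ### Waiting times of the broadcast sequence -/

/-- If every `M` consecutive numbers `j` contain one with the property `p`, then any `6 * M`
consecutive steps `t` contain one of a prescribed residue modulo `3` for which `t / 3` has the
property: they contain `M` complete blocks of three. -/
theorem exists_block_in_window {p : ℕ → Prop} {M : ℕ}
    (h : ∀ j₀, ∃ j, j₀ ≤ j ∧ j < j₀ + M ∧ p j) {e : ℕ} (he : e < 3) (t₀ : ℕ) :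
    ∃ t, t₀ < t ∧ t ≤ t₀ + 6 * M ∧ t % 3 = e ∧ p (t / 3) := by
  obtain ⟨j, h1, h2, hp⟩ := h (t₀ / 3 + 1)
  refine ⟨3 * j + e, by omega, by omega, by omega, ?_⟩
  rwa [show (3 * j + e) / 3 = j by omega]

theorem exists_mod_eq_in_window {M b : ℕ} (hb : b < M) (j₀ : ℕ) :
    ∃ j, j₀ ≤ j ∧ j < j₀ + M ∧ j % M = b := by
  have hM : 0 < M := by omega
  have hlt := Nat.mod_lt j₀ hM
  have hdm := Nat.div_add_mod j₀ M
  rcases le_or_gt (j₀ % M) b with h | h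
  · exact ⟨M * (j₀ / M) + b, by omega, by omega, by simp [Nat.mod_eq_of_lt hb]⟩
  · exact ⟨M * (j₀ / M + 1) + b, by rw [mul_add]; omega, by rw [mul_add]; omega,
      by simp [Nat.mod_eq_of_lt hb]⟩

/-- Residues modulo `nu` with exactly `i` factors `2` occur at distance `2 * 2 ^ i` within a period,
and at most `2 ^ i` is added to this where a period ends. -/
theorem exists_padicValNat_mod_eq_in_window {nu i : ℕ} (h : 2 ^ i < nu) (j₀ : ℕ) :
    ∃ j, j₀ ≤ j ∧ j < j₀ + 3 * 2 ^ i ∧ padicValNat 2 (j % nu) = i := by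
  have hnu : 0 < nu := (Nat.zero_le _).trans_lt h
  have hlt := Nat.mod_lt j₀ hnu
  have hdm := Nat.div_add_mod j₀ nu
  have hpos : 0 < 2 ^ i := by positivity
  have hval : ∀ c, padicValNat 2 (2 ^ i * (2 * c + 1)) = i := by
    intro c
    rw [padicValNat.mul (by positivity) (by omega), padicValNat.prime_pow,
      padicValNat.eq_zero_of_not_dvd (by omega), add_zero]
  -- the next odd multiple of `2 ^ i` after the residue of `j₀`
  obtain ⟨c, hc1, hc2⟩ : ∃ c, j₀ % nu ≤ 2 ^ i * (2 * c + 1) ∧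
      2 ^ i * (2 * c + 1) < j₀ % nu + 2 * 2 ^ i := by
    obtain ⟨j, h1, h2, h3⟩ := exists_mod_eq_in_window (M := 2 * 2 ^ i) (b := 2 ^ i) (by omega)
      (j₀ % nu)
    refine ⟨j / (2 * 2 ^ i), ?_⟩
    have hj := Nat.div_add_mod j (2 * 2 ^ i)
    rw [h3] at hj
    have : 2 ^ i * (2 * (j / (2 * 2 ^ i)) + 1) = j := by
      conv_rhs => rw [← hj]
      ring
    omega
  rcases lt_or_ge (2 ^ i * (2 * c + 1)) nu with hlt' | hge
  · refine ⟨nu * (j₀ / nu) + 2 ^ i * (2 * c + 1), by omega, by omega, ?_⟩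
    rw [Nat.mul_add_mod, Nat.mod_eq_of_lt hlt', hval]
  · refine ⟨nu * (j₀ / nu + 1) + 2 ^ i, by rw [mul_add]; omega, by rw [mul_add]; omega, ?_⟩
    rw [Nat.mul_add_mod, Nat.mod_eq_of_lt h, padicValNat.prime_pow]

/-- Every exponent `b < nu` recurs in the broadcast sequence, after at most of the order of
`lam + 2 ^ b / 2 ^ lam` steps, and also after at most of the order of `lam + nu` steps: it is found among the terms
`j mod lam` if `b < lam`, among the terms `lam + i` if `2 ^ (b - lam) < nu`, and otherwise among the
terms `j mod nu`, whose period `nu` is then at most `2 ^ b / 2 ^ lam`. -/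
theorem exists_bcSeq_eq_in_window {lam nu b : ℕ} (hlam : 1 ≤ lam) (hb : b < nu) :
    ∃ w : ℕ, 1 ≤ w ∧ w ≤ 18 * max lam nu ∧ (w : ℝ) ≤ 18 * (lam + 2 ^ b / 2 ^ lam) ∧
      ∀ t₀, ∃ t, t₀ < t ∧ t ≤ t₀ + w ∧ bcSeq lam nu t = b := by
  have hlam' : (1 : ℝ) ≤ lam := by exact_mod_cast hlam
  rcases lt_or_ge b lam with hbl | hbl
  · refine ⟨6 * lam, by omega, by omega, ?_, fun t₀ => ?_⟩
    · have : (0 : ℝ) ≤ 2 ^ b / 2 ^ lam := by positivity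
      push_cast
      linarith
    · obtain ⟨t, h1, h2, h3, h4⟩ := exists_block_in_window
        (exists_mod_eq_in_window hbl) (e := 1) (by omega) t₀
      exact ⟨t, h1, h2, by simp [bcSeq, h3, h4]⟩
  obtain ⟨i, rfl⟩ := Nat.exists_eq_add_of_le hbl
  have hdiv : (2 : ℝ) ^ (lam + i) / 2 ^ lam = 2 ^ i := by
    rw [pow_add]
    field_simp
  rw [hdiv]
  rcases lt_or_ge (2 ^ i) nu with hi | hi
  · refine ⟨6 * (3 * 2 ^ i), by have : 0 < 2 ^ i := by positivity
                                omega, by omega, ?_, fun t₀ => ?_⟩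
    · push_cast
      linarith
    · obtain ⟨t, h1, h2, h3, h4⟩ := exists_block_in_window
        (exists_padicValNat_mod_eq_in_window hi) (e := 0) (by omega) t₀
      exact ⟨t, h1, h2, by simp [bcSeq, h3, h4]⟩
  · refine ⟨6 * nu, by omega, by omega, ?_, fun t₀ => ?_⟩
    · have : (nu : ℝ) ≤ 2 ^ i := by exact_mod_cast hi
      push_cast
      linarith
    · obtain ⟨t, h1, h2, h3, h4⟩ := exists_block_in_window
        (exists_mod_eq_in_window hb) (e := 2) (by omega) t₀
      exact ⟨t, h1, h2, by simp [bcSeq, h3, h4]⟩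

/-! ### Consistency of the packets and the union bound -/

section Delivery

variable {V : Type*} [Fintype V] {k m : ℕ}

theorem mem_support_of_mem_support_independent {α : Type*} [Fintype α] {p : V → PMF α}
    {a : V → α} (ha : a ∈ (independent p).support) (v : V) : a v ∈ (p v).support := by
  rw [PMF.mem_support_iff] at ha ⊢
  have h : ∏ v, p v (a v) ≠ 0 := by simpa [independent] using ha
  exact Finset.prod_ne_zero_iff.1 h v (Finset.mem_univ v)

theorem exists_sum_of_mem_support_nodeAction {lam nu C i cyc : ℕ} {c : Fin C}
    {P : Finset (Packet k m)} {x : Packet k m}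
    (h : some x ∈ (nodeAction lam nu C i cyc c P).support) : ∃ S ⊆ P, x = ∑ y ∈ S, y := by
  unfold nodeAction at h
  split_ifs at h
  · obtain ⟨o, -, ho⟩ := (PMF.mem_support_bind_iff _ _ _).1 h
    split_ifs at ho
    · obtain ⟨S, hS, hx⟩ := (PMF.mem_support_map_iff _ _ _).1 ho
      refine ⟨S, ?_, (Option.some.inj hx).symm⟩
      exact Finset.mem_powerset.1 ((PMF.mem_support_uniformOfFinset_iff _ _).1 hS)
    · simp at ho
  · simp at h

theorem consistent_of_mem_support_run (G : SimpleGraph V) {C : ℕ} (color : V → Fin C)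
    (lam nu : ℕ) (s : V) (msg : Fin k → Message m) (r : ℕ) {P : V → Finset (Packet k m)}
    (hP : P ∈ (run G color lam nu s msg r).support) (u : V) :
    ∀ x ∈ P u, Consistent msg x := by
  induction r generalizing P u with
  | zero =>
    rw [run, PMF.support_pure, Set.mem_singleton_iff] at hP
    subst hP
    intro x hx
    simp only [initialBuffers] at hx
    split_ifs at hx
    · obtain ⟨i, -, rfl⟩ := Finset.mem_image.1 hx
      rw [Consistent, Finset.sum_eq_single i]
      · simp [basisPacket]
      · intro j _ hj
        simp [basisPacket, hj]
      · simp
    · simp at hx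
  | succ r ih =>
    obtain ⟨Q, hQ, hstep⟩ := (PMF.mem_support_bind_iff _ _ _).1 hP
    obtain ⟨act, hact, rfl⟩ := (PMF.mem_support_map_iff _ _ _).1 hstep
    intro x hx
    simp only [updateBuffers, Finset.mem_union, Finset.mem_filter, Finset.mem_univ,
      true_and] at hx
    rcases hx with hx | hx
    · exact ih hQ u x hx
    · obtain ⟨-, w, -, hw, -⟩ := hx
      have hsup := mem_support_of_mem_support_independent hact w
      rw [hw] at hsup
      obtain ⟨S, hS, rfl⟩ := exists_sum_of_mem_support_nodeAction hsup
      exact (consistentSubmodule msg).sum_mem fun y hy => ih hQ w y (hS hy)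

open Classical in
/-- If some node fails to decode some message, then some node does not know some nonzero `μ`. -/
theorem one_sub_sum_ignorance_le_successProb (G : SimpleGraph V) {C : ℕ} (color : V → Fin C)
    (lam nu : ℕ) (s : V) (msg : Fin k → Message m) (T : ℕ) :
    1 - ∑ μ : Fin k → ZMod 2 with μ ≠ 0, ∑ v,
      (ignorance G color lam nu s msg μ (C * T) v).toReal ≤
      successProb G color lam nu s msg T := by
  set p := run G color lam nu s msg (C * T) with hp
  have hfin : ∀ μ v, ignorance G color lam nu s msg μ (C * T) v ≠ ∞ := fun μ v =>
    ignorance_ne_top G color lam nu s msg μ _ v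
  have hbad : p.toOuterMeasure {P | AllDelivered msg P}ᶜ ≤
      ∑ μ : Fin k → ZMod 2 with μ ≠ 0, ∑ v, ignorance G color lam nu s msg μ (C * T) v := by
    rw [← PMF.toOuterMeasure_apply_inter_support]
    calc p.toOuterMeasure ({P | AllDelivered msg P}ᶜ ∩ p.support)
        ≤ p.toOuterMeasure (⋃ μ ∈ Finset.univ.filter fun μ : Fin k → ZMod 2 => μ ≠ 0,
            ⋃ v ∈ (Finset.univ : Finset V), {P | ¬ Knows μ (P v)}) := by
          refine MeasureTheory.measure_mono ?_
          rintro P ⟨hP, hsupp⟩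
          by_contra hcon
          simp only [Finset.mem_filter, Finset.mem_univ, true_and, Set.mem_iUnion,
            Set.mem_ofPred_eq, exists_prop, not_exists, not_and, not_not] at hcon
          exact hP fun u i => decode_eq_some
            (consistent_of_mem_support_run G color lam nu s msg _ hsupp u)
            (fun μ hμ => hcon μ hμ u) i
      _ ≤ ∑ μ : Fin k → ZMod 2 with μ ≠ 0, ∑ v, p.toOuterMeasure {P | ¬ Knows μ (P v)} := by
          refine (MeasureTheory.measure_biUnion_finset_le _ _).trans ?_
          exact Finset.sum_le_sum fun μ _ => MeasureTheory.measure_biUnion_finset_le _ _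
  have htotal : 1 ≤ p.toOuterMeasure {P | AllDelivered msg P} +
      p.toOuterMeasure {P | AllDelivered msg P}ᶜ := by
    rw [← toOuterMeasure_univ p, ← Set.union_compl_self {P | AllDelivered msg P}]
    exact MeasureTheory.measure_union_le _ _
  have hsumfin : ∑ μ : Fin k → ZMod 2 with μ ≠ 0, ∑ v,
      ignorance G color lam nu s msg μ (C * T) v ≠ ∞ :=
    (ENNReal.sum_lt_top.2 fun μ _ => ENNReal.sum_lt_top.2 fun v _ => (hfin μ v).lt_top).ne
  have hgood : p.toOuterMeasure {P | AllDelivered msg P} ≠ ∞ :=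
    ((toOuterMeasure_le_one p _).trans_lt ENNReal.one_lt_top).ne
  have hreal := ENNReal.toReal_mono (ENNReal.add_ne_top.2 ⟨hgood, hsumfin⟩)
    (htotal.trans (add_le_add_right hbad _))
  rw [ENNReal.toReal_add hgood hsumfin, ENNReal.toReal_sum fun μ _ =>
    (ENNReal.sum_lt_top.2 fun v _ => (hfin μ v).lt_top).ne, ENNReal.toReal_one] at hreal
  simp_rw [ENNReal.toReal_sum fun v _ => hfin _ v] at hreal
  rw [successProb]
  linarith

end Delivery

/-! ### Iterations -/

section Iteration

variable {V : Type*} [Fintype V] {k m : ℕ} (G : SimpleGraph V) {C : ℕ} (color : V → Fin C)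
  (lam nu : ℕ) (s : V) (msg : Fin k → Message m) (μ : Fin k → ZMod 2)

/-- The probability that node `v` does not know `μ` after `t` iterations. -/
noncomputable def iterIgnorance (t : ℕ) (v : V) : ℝ :=
  (ignorance G color lam nu s msg μ (C * t) v).toReal

theorem antitone_iterIgnorance (v : V) :
    Antitone fun t => iterIgnorance G color lam nu s msg μ t v := fun _ _ h =>
  ENNReal.toReal_mono (ignorance_ne_top G color lam nu s msg μ _ v)
    (antitone_ignorance G color lam nu s msg μ v (Nat.mul_le_mul_left C h))

/-- An iteration whose exponent fits the number of senders of color `c` contains a suitable round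
for `v`, namely the one of color `c`. -/
theorem iterIgnorance_succ_le {v : V} {c : Fin C} (hvc : color v ≠ c) {t : ℕ}
    (h1 : 2 ^ bcSeq lam nu (t + 1) ≤ (senders G color v c).card)
    (h2 : (senders G color v c).card < 2 ^ (bcSeq lam nu (t + 1) + 1)) {B : ℝ}
    (hB : ∀ u ∈ senders G color v c, iterIgnorance G color lam nu s msg μ t u ≤ B) :
    iterIgnorance G color lam nu s msg μ (t + 1) v ≤
      31 / 32 * iterIgnorance G color lam nu s msg μ t v + 1 / 32 * B := by
  have hC : 0 < C := c.pos
  have hd : 0 < (senders G color v c).card := lt_of_lt_of_le (by positivity) h1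
  have hB0 : 0 ≤ B := by
    obtain ⟨u, hu⟩ := Finset.card_pos.1 hd
    exact ENNReal.toReal_nonneg.trans (hB u hu)
  set e := (c + C - 1) % C with he
  have heC : e < C := Nat.mod_lt _ hC
  have hmod : (C * t + e) % C = e := by rw [Nat.mul_add_mod, Nat.mod_eq_of_lt heC]
  have hdiv : (C * t + e) / C = t := by
    rw [Nat.mul_add_div hC, Nat.div_eq_of_lt heC, add_zero]
  have hcyc : (C * t + e) % C + 1 ≡ c [MOD C] := by
    have h : (c + C - 1) % C + 1 ≡ c + C - 1 + 1 [MOD C] := (Nat.mod_modEq _ _).add_right 1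
    rw [hmod]
    refine h.trans ?_
    rw [show (c : ℕ) + C - 1 + 1 = c + C by omega]
    simp [Nat.ModEq]
  have hstep := ignorance_succ_le G color lam nu s msg μ hvc hcyc (by rwa [hdiv]) (by rwa [hdiv])
  have hle : ignorance G color lam nu s msg μ (C * (t + 1)) v ≤
      (1 - 32⁻¹) * ignorance G color lam nu s msg μ (C * t) v + 32⁻¹ * ENNReal.ofReal B := by
    refine (antitone_ignorance G color lam nu s msg μ v
      (show C * t + e + 1 ≤ C * (t + 1) by rw [mul_add]; omega)).trans (hstep.trans ?_)
    refine add_le_add (mul_le_mul_right (antitone_ignorance G color lam nu s msg μ v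
      (Nat.le_add_right _ _)) _) ?_
    rw [← natCast_mul_inv_mul hd.ne', mul_assoc, ← nsmul_eq_mul, ← Finset.sum_const]
    refine Finset.sum_le_sum fun u hu => mul_le_mul_right ?_ _
    refine (antitone_ignorance G color lam nu s msg μ u (Nat.le_add_right _ _)).trans ?_
    rw [ENNReal.le_ofReal_iff_toReal_le (ignorance_ne_top G color lam nu s msg μ _ u) hB0]
    exact hB u hu
  have hn1 : (1 - 32⁻¹ : ℝ≥0∞) * ignorance G color lam nu s msg μ (C * t) v ≠ ∞ :=
    ENNReal.mul_ne_top (ne_top_of_le_ne_top ENNReal.one_ne_top tsub_le_self)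
      (ignorance_ne_top G color lam nu s msg μ _ v)
  have hn2 : (32⁻¹ : ℝ≥0∞) * ENNReal.ofReal B ≠ ∞ :=
    ENNReal.mul_ne_top (by simp) ENNReal.ofReal_ne_top
  have hreal := ENNReal.toReal_mono (ENNReal.add_ne_top.2 ⟨hn1, hn2⟩) hle
  rw [ENNReal.toReal_add hn1 hn2, ENNReal.toReal_mul, ENNReal.toReal_mul,
    ENNReal.toReal_ofReal hB0, ENNReal.toReal_sub_of_le
      (ENNReal.inv_le_one.2 (by norm_num)) ENNReal.one_ne_top] at hreal
  refine hreal.trans (le_of_eq ?_)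
  rw [iterIgnorance]
  norm_num

end Iteration

/-! ### Layers -/

section Layers

variable {V : Type*} {G : SimpleGraph V} {s : V} {layer : V → ℤ}

theorem IsLayering.nonneg [Finite V] (h : IsLayering G s layer) (u : V) : 0 ≤ layer u := by
  have : Nonempty V := ⟨u⟩
  obtain ⟨v, hv⟩ := Finite.exists_min layer
  by_cases hvs : v = s
  · rw [← (h.source_iff v).2 hvs]
    exact hv u
  · obtain ⟨w, -, hw⟩ := h.exists_lower v hvs
    exact absurd (hv w) (not_le.2 hw)

theorem CollisionFree.color_ne_of_adj {C : ℕ} {color : V → Fin C}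
    (h : CollisionFree G layer color) {u v : V} (hadj : G.Adj u v) (hne : layer u ≠ layer v) :
    color u ≠ color v :=
  h u v hne ((SimpleGraph.Walk.edist_le hadj.toWalk).trans (by simp))

theorem CollisionFree.layer_eq_of_adj_of_adj {C : ℕ} {color : V → Fin C}
    (h : CollisionFree G layer color) {u v w : V} (hu : G.Adj v u) (hw : G.Adj v w)
    (hc : color u = color w) : layer u = layer w := by
  by_contra hne
  refine h u w hne ?_ hc
  exact (SimpleGraph.Walk.edist_le (SimpleGraph.Walk.cons hu.symm hw.toWalk)).trans (by simp)

/-- The number of nodes of layer `j`. -/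
noncomputable def layerSize [Fintype V] (layer : V → ℤ) (j : ℕ) : ℕ :=
  open Classical in (Finset.univ.filter fun u => (layer u).toNat = j).card

theorem sum_layerSize_le [Fintype V] (layer : V → ℤ) (S : Finset ℕ) :
    ∑ j ∈ S, layerSize layer j ≤ Fintype.card V := by
  classical
  simp only [layerSize]
  rw [← Finset.card_biUnion]
  · exact Finset.card_le_univ _
  · intro i _ j _ hij
    refine Finset.disjoint_left.2 fun u hu hu' => hij ?_
    simp only [Finset.mem_filter, Finset.mem_univ, true_and] at hu hu'
    exact hu.symm.trans hu'

end Layers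

/-! ### The tail bound for one direction -/

section Tail

theorem le_two_rpow_mul_two_pow {n D lam : ℕ} {a : ℝ} (hn : 0 < n) (hD : 0 < D)
    (h : logRatio n D - a ≤ lam) : (n : ℝ) / D ≤ 2 ^ a * 2 ^ lam := by
  have hnD : (0 : ℝ) < (n : ℝ) / D := by positivity
  rw [← Real.rpow_natCast, ← Real.rpow_add (by norm_num),
    ← Real.logb_le_iff_le_rpow (by norm_num) hnD]
  have : Real.logb 2 ((n : ℝ) / D) ≤ logRatio n D := le_max_right _ _
  linarith

theorem logRatio_le_logb {n D : ℕ} (hn : 2 ≤ n) (hD : 0 < D) :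
    logRatio n D ≤ Real.logb 2 n := by
  have hn' : (2 : ℝ) ≤ n := by exact_mod_cast hn
  refine max_le ?_ (Real.logb_le_logb_of_le (by norm_num) (by positivity) ?_)
  · rw [Real.le_logb_iff_rpow_le (by norm_num) (by positivity)]
    simpa using hn'
  · exact div_le_self (by positivity) (by exact_mod_cast hD)

variable {V : Type*} [Fintype V]

/-- The potential of layer `l`: the total waiting time, up to a constant, that a path which uses
one set of senders in each layer below `l` has to spend. -/
noncomputable def layerPotential (layer : V → ℤ) (lam : ℕ) (ρ : ℝ) (l : ℕ) : ℝ :=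
  ∑ j ∈ Finset.range l, 129 * (18 * (lam + ρ * layerSize layer j))

theorem monotone_layerPotential (layer : V → ℤ) (lam : ℕ) {ρ : ℝ} (hρ : 0 ≤ ρ) :
    Monotone (layerPotential layer lam ρ) := by
  intro l l' h
  exact Finset.sum_le_sum_of_subset_of_nonneg (Finset.range_subset_range.2 h)
    fun j _ _ => by positivity

theorem layerPotential_le (layer : V → ℤ) (lam : ℕ) {ρ : ℝ} (hρ : 0 ≤ ρ) (l : ℕ) :
    layerPotential layer lam ρ l ≤ 2322 * (l * lam + ρ * Fintype.card V) := by
  have h : (∑ j ∈ Finset.range l, (layerSize layer j : ℝ)) ≤ Fintype.card V := by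
    exact_mod_cast sum_layerSize_le layer (Finset.range l)
  have h' := mul_le_mul_of_nonneg_left h hρ
  rw [layerPotential, ← Finset.mul_sum, ← Finset.mul_sum, Finset.sum_add_distrib,
    ← Finset.mul_sum, Finset.sum_const, Finset.card_range, nsmul_eq_mul]
  linarith

/-- After `t` iterations, a node on layer `l` is ignorant of `μ` with probability exponentially
small in the excess of `t` over the potential of layer `l`, on the scale of `max lam nu`. -/
theorem iterIgnorance_le_exp {k m : ℕ} {G : SimpleGraph V} {s : V} {layer : V → ℤ}
    (hlayer : IsLayering G s layer) {C : ℕ} {color : V → Fin C}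
    (hcolor : CollisionFree G layer color) {lam nu : ℕ} (hlam : 1 ≤ lam)
    (hnu : Fintype.card V ≤ 2 ^ nu) {ρ : ℝ} (hρ : 1 ≤ ρ * 2 ^ lam) (msg : Fin k → Message m)
    {μ : Fin k → ZMod 2} (hμ : μ ≠ 0) {θ : ℝ} (hθ : 0 ≤ θ)
    (hθw : 128 * θ * (18 * max lam nu : ℕ) ≤ 1) (t : ℕ) (v : V) :
    iterIgnorance G color lam nu s msg μ t v ≤
      Real.exp (θ * (layerPotential layer lam ρ (layer v).toNat - t)) := by
  classical
  have hpow : (0 : ℝ) < 2 ^ lam := by positivity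
  have hρ0 : 0 ≤ ρ := by
    by_contra! h
    nlinarith
  -- every node listens to the neighbours that share the color of one lower neighbour
  have hpar : ∀ v, ∃ u, v ≠ s → G.Adj v u ∧ layer u < layer v := by
    intro v
    by_cases hvs : v = s
    · exact ⟨v, fun h => absurd hvs h⟩
    · obtain ⟨u, hu⟩ := hlayer.exists_lower v hvs
      exact ⟨u, fun _ => hu⟩
  choose par hpar using hpar
  set U : V → Finset V := fun v => senders G color v (color (par v)) with hU
  have hparU : ∀ v, v ≠ s → par v ∈ U v := fun v hv => mem_senders.2 ⟨(hpar v hv).1, rfl⟩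
  have hUlayer : ∀ v, v ≠ s → ∀ u ∈ U v, layer u = layer (par v) := fun v hv u hu =>
    hcolor.layer_eq_of_adj_of_adj (mem_senders.1 hu).1 (hpar v hv).1 (mem_senders.1 hu).2
  have hcard : ∀ v, v ≠ s → 0 < (U v).card := fun v hv =>
    Finset.card_pos.2 ⟨par v, hparU v hv⟩
  have hlog : ∀ v, v ≠ s → Nat.log 2 (U v).card < nu := by
    intro v hv
    refine Nat.log_lt_of_lt_pow (hcard v hv).ne' (lt_of_lt_of_le ?_ hnu)
    refine Finset.card_lt_univ_of_notMem (x := v) fun hvU => ?_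
    exact G.loopless.irrefl v (mem_senders.1 hvU).1
  have hwait : ∀ v, ∃ w : ℕ, v ≠ s → 1 ≤ w ∧ w ≤ 18 * max lam nu ∧
      (w : ℝ) ≤ 18 * (lam + 2 ^ Nat.log 2 (U v).card / 2 ^ lam) ∧
      ∀ t₀, ∃ t, t₀ < t ∧ t ≤ t₀ + w ∧ bcSeq lam nu t = Nat.log 2 (U v).card := by
    intro v
    by_cases hvs : v = s
    · exact ⟨0, fun h => absurd hvs h⟩
    · obtain ⟨w, hw⟩ := exists_bcSeq_eq_in_window hlam (hlog v hvs)
      exact ⟨w, fun _ => hw⟩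
  choose w hw using hwait
  have hW0 : ∀ l, 0 ≤ layerPotential layer lam ρ l := fun l =>
    Finset.sum_nonneg fun j _ => by positivity
  -- the senders of `v` fill at most their layer, which bounds the waiting time of `v`
  have hWU : ∀ v, v ≠ s → ∀ u ∈ U v, layerPotential layer lam ρ (layer u).toNat + 129 * w v ≤
      layerPotential layer lam ρ (layer v).toNat := by
    intro v hv u hu
    have hlt : (layer u).toNat + 1 ≤ (layer v).toNat := by
      have h1 := hUlayer v hv u hu
      have h2 := (hpar v hv).2
      have h3 := hlayer.nonneg u
      omega
    refine le_trans ?_ (monotone_layerPotential layer lam hρ0 hlt)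
    rw [layerPotential, layerPotential, Finset.sum_range_succ]
    have hsub : (U v).card ≤ layerSize layer (layer u).toNat := by
      refine Finset.card_le_card fun x hx => ?_
      simp [hUlayer v hv x hx, hUlayer v hv u hu]
    have hdpow : (2 : ℝ) ^ Nat.log 2 (U v).card ≤ layerSize layer (layer u).toNat := by
      exact_mod_cast (Nat.pow_log_le_self 2 (hcard v hv).ne').trans hsub
    have hdiv : (2 : ℝ) ^ Nat.log 2 (U v).card / 2 ^ lam ≤
        ρ * layerSize layer (layer u).toNat := by
      rw [div_le_iff₀ hpow]
      calc (2 : ℝ) ^ Nat.log 2 (U v).card ≤ 1 * layerSize layer (layer u).toNat := by linarith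
        _ ≤ ρ * 2 ^ lam * layerSize layer (layer u).toNat := by gcongr
        _ = _ := by ring
    linarith [(hw v hv).2.2.1]
  refine le_exp_of_hitting (s := s) (U := fun v => (U v : Set V)) (w := w)
    (W := fun v => layerPotential layer lam ρ (layer v).toNat) ?_ ?_ hθ
    (fun v hv => (hw v hv).1) hWU ?_ ?_ ?_ t v
  · intro t v
    exact ENNReal.toReal_mono ENNReal.one_ne_top (ignorance_le_one G color lam nu s msg μ _ v)
  · intro t
    simp [iterIgnorance, ignorance_source G color lam nu s msg hμ]
  · intro v hv
    have h1 := hWU v hv (par v) (hparU v hv)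
    have h2 := hW0 (layer (par v)).toNat
    have h3 : (0 : ℝ) ≤ w v := by positivity
    linarith
  · intro v hv
    refine le_trans ?_ hθw
    gcongr
    exact (hw v hv).2.1
  · intro v hv t₀ B hB
    have hanti := antitone_iterIgnorance G color lam nu s msg μ
    obtain ⟨t, h1, h2, h3⟩ := (hw v hv).2.2.2 t₀
    obtain ⟨t', rfl⟩ : ∃ t', t = t' + 1 := ⟨t - 1, by omega⟩
    have hvc : color v ≠ color (par v) :=
      hcolor.color_ne_of_adj (hpar v hv).1 (hpar v hv).2.ne'
    have hstep := iterIgnorance_succ_le G color lam nu s msg μ hvc (t := t') (B := B)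
      (by rw [h3]; exact Nat.pow_log_le_self 2 (hcard v hv).ne')
      (by rw [h3]; exact Nat.lt_pow_succ_log_self (by norm_num) _)
      (fun u hu => (hanti u (by omega : t₀ ≤ t')).trans (hB u hu))
    have h4 := hanti v h2
    have h5 := hanti v (by omega : t₀ ≤ t')
    simp only at h4 h5
    linarith

end Tail

end RadioNC

theorem mainTheorem6 (β : ℝ) (hβ : 2 ≤ β) (a : ℝ) (ha : 1 ≤ a) :
    ∃ A : ℝ, 0 < A ∧
      ∀ (V : Type*) [Fintype V] (G : SimpleGraph V) (_hG : G.Connected)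
        (s : V) (layer : V → ℤ) (_hlayer : RadioNC.IsLayering G s layer)
        (D : ℕ) (_hD : RadioNC.HasDepth layer D)
        (C : ℕ) (color : V → Fin C) (_hcolor : RadioNC.CollisionFree G layer color)
        (nu : ℕ) (_hnu : 1 ≤ nu)
        (_hnu_lower : Real.logb 2 (Fintype.card V) ≤ nu)
        (_hnu_upper : (nu : ℝ) ≤ a * max 1 (Real.logb 2 (Fintype.card V)))
        (lam : ℕ) (_hlam : 1 ≤ lam)
        (_hlam_lower : RadioNC.logRatio (Fintype.card V) D - a ≤ lam)
        (_hlam_upper : (lam : ℝ) ≤ a * RadioNC.logRatio (Fintype.card V) D)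
        (k m : ℕ) (msg : Fin k → RadioNC.Message m)
        (T : ℕ) (_hT : A * RadioNC.iterationBound (Fintype.card V) D k ≤ T),
        1 - (Fintype.card V : ℝ) ^ (-β) ≤ RadioNC.successProb G color lam nu s msg T := by
  classical
  -- the first summand pays for the potential of the deepest layer, the second one for the tail
  refine ⟨2322 * (a + 2 ^ a) + 2304 * a * (β + 1), by positivity, ?_⟩
  intro V _ G _ s layer hlayer D hD C color hcolor nu hnu hnu_lower hnu_upper lam hlam hlam_lower
    hlam_upper k m msg T hT
  set n := Fintype.card V with hn
  have hnpos : 0 < n := Fintype.card_pos_iff.2 ⟨s⟩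
  rcases Nat.lt_or_ge n 2 with hn2 | hn2
  · have hn1 : n = 1 := by omega
    rw [hn1]
    simp only [Nat.cast_one, Real.one_rpow, sub_self]
    exact ENNReal.toReal_nonneg
  have hnR : (0 : ℝ) < n := by exact_mod_cast hnpos
  have hDle : ∀ v, (layer v).toNat ≤ D := by
    intro v
    have := hD.2 ⟨v, rfl⟩
    omega
  have hDpos : 0 < D := by
    obtain ⟨v, hv⟩ := Fintype.exists_ne_of_one_lt_card (by omega : 1 < Fintype.card V) s
    have h1 := hlayer.nonneg v
    have h2 : layer v ≠ 0 := fun h => hv ((hlayer.source_iff v).1 h)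
    have := hDle v
    omega
  have hDR : (1 : ℝ) ≤ D := by exact_mod_cast hDpos
  set L := Real.logb 2 n with hL
  set Λ := RadioNC.logRatio n D with hΛ
  have hΛ1 : 1 ≤ Λ := le_max_left _ _
  have hΛL : Λ ≤ L := RadioNC.logRatio_le_logb hn2 hDpos
  have hL1 : 1 ≤ L := hΛ1.trans hΛL
  have hn_pow : Fintype.card V ≤ 2 ^ nu := by
    have h := (Real.logb_le_iff_le_rpow (by norm_num) hnR).1 hnu_lower
    rw [Real.rpow_natCast] at h
    exact_mod_cast h
  set ρ : ℝ := 2 ^ a * D / n with hρ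
  have hρ0 : 0 ≤ ρ := by positivity
  have hρ1 : 1 ≤ ρ * 2 ^ lam := by
    have h := RadioNC.le_two_rpow_mul_two_pow hnpos hDpos hlam_lower
    rw [div_le_iff₀ (by positivity)] at h
    rw [hρ, div_mul_eq_mul_div, le_div_iff₀ hnR]
    linarith
  have ha0 : 0 < a := by linarith
  set θ : ℝ := (2304 * a * L)⁻¹ with hθ
  have hθ0 : 0 < θ := by positivity
  have hθL : θ * (2304 * a * L) = 1 := inv_mul_cancel₀ (by positivity)
  have hθw : 128 * θ * (18 * max lam nu : ℕ) ≤ 1 := by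
    have hmax : ((max lam nu : ℕ) : ℝ) ≤ a * L := by
      rw [Nat.cast_max]
      refine max_le (hlam_upper.trans (by gcongr)) (hnu_upper.trans ?_)
      rw [max_eq_right hL1]
    calc 128 * θ * (18 * max lam nu : ℕ) = 2304 * θ * (max lam nu : ℕ) := by push_cast; ring
      _ ≤ 2304 * θ * (a * L) := by gcongr
      _ = 1 := by rw [← hθL]; ring
  have hbound : ∀ v, θ * (RadioNC.layerPotential layer lam ρ (layer v).toNat - T) ≤
      -((β + 1) * (k + L)) := by
    intro v
    have hW : RadioNC.layerPotential layer lam ρ (layer v).toNat ≤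
        2322 * (a + 2 ^ a) * (D * Λ) := by
      refine (RadioNC.monotone_layerPotential layer lam hρ0 (hDle v)).trans
        ((RadioNC.layerPotential_le layer lam hρ0 D).trans ?_)
      have h1 : ρ * Fintype.card V = 2 ^ a * (D * 1) := by
        rw [hρ, ← hn]
        field_simp
      have h2 : (2 : ℝ) ^ a * (D * 1) ≤ 2 ^ a * (D * Λ) := by gcongr
      have h3 : (D : ℝ) * lam ≤ D * (a * Λ) := by gcongr
      rw [h1]
      linarith
    have hT' : 2322 * (a + 2 ^ a) * (D * Λ) + 2304 * a * L * ((β + 1) * (k + L)) ≤ T := by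
      refine le_trans ?_ hT
      rw [RadioNC.iterationBound, ← hL, ← hΛ]
      have h1 : 0 ≤ 2304 * a * (β + 1) * (D * Λ) := by positivity
      have h2 : 0 ≤ 2322 * (a + 2 ^ a) * (k * L + L ^ 2) := by positivity
      linarith
    calc θ * (RadioNC.layerPotential layer lam ρ (layer v).toNat - T)
        ≤ θ * -(2304 * a * L * ((β + 1) * (k + L))) := by gcongr; linarith
      _ = -(θ * (2304 * a * L) * ((β + 1) * (k + L))) := by ring
      _ = _ := by rw [hθL, one_mul]
  have hexp : Real.exp (-((β + 1) * (k + L))) ≤ (2 ^ k)⁻¹ * ((n : ℝ)⁻¹ * n ^ (-β)) := by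
    have hlog2 : Real.log 2 ≤ 1 := by
      have := Real.log_le_sub_one_of_pos (show (0 : ℝ) < 2 by norm_num)
      linarith
    have hlog20 : 0 < Real.log 2 := Real.log_pos (by norm_num)
    have hlogn : Real.log n = L * Real.log 2 := by
      rw [hL, Real.logb, div_mul_cancel₀ _ hlog20.ne']
    have h1 : ((2 : ℝ) ^ k)⁻¹ = Real.exp (-(k * Real.log 2)) := by
      rw [Real.exp_neg, ← Real.log_pow, Real.exp_log (by positivity)]
    have h2 : (n : ℝ)⁻¹ = Real.exp (-(L * Real.log 2)) := by
      rw [Real.exp_neg, ← hlogn, Real.exp_log hnR]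
    have h3 : (n : ℝ) ^ (-β) = Real.exp (-(β * (L * Real.log 2))) := by
      rw [Real.rpow_def_of_pos hnR, hlogn]
      congr 1
      ring
    rw [h1, h2, h3, ← Real.exp_add, ← Real.exp_add, Real.exp_le_exp]
    have h4 : (k : ℝ) * Real.log 2 ≤ k * 1 := by gcongr
    have h5 : L * Real.log 2 ≤ L * 1 := by gcongr
    have h6 : β * (L * Real.log 2) ≤ β * (L * 1) := by gcongr
    have h7 : 0 ≤ β * k := by positivity
    linarith
  have htail : ∀ μ : Fin k → ZMod 2, μ ≠ 0 → ∀ v,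
      (RadioNC.ignorance G color lam nu s msg μ (C * T) v).toReal ≤
        (2 ^ k)⁻¹ * ((n : ℝ)⁻¹ * n ^ (-β)) := fun μ hμ v =>
    (RadioNC.iterIgnorance_le_exp hlayer hcolor hlam hn_pow hρ1 msg hμ hθ0.le hθw T v).trans
      ((Real.exp_le_exp.2 (hbound v)).trans hexp)
  have hunion : ∑ μ : Fin k → ZMod 2 with μ ≠ 0, ∑ v,
      (RadioNC.ignorance G color lam nu s msg μ (C * T) v).toReal ≤ (n : ℝ) ^ (-β) := by
    calc ∑ μ : Fin k → ZMod 2 with μ ≠ 0, ∑ v,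
          (RadioNC.ignorance G color lam nu s msg μ (C * T) v).toReal
        ≤ ∑ μ : Fin k → ZMod 2 with μ ≠ 0, ∑ _v : V,
          ((2 : ℝ) ^ k)⁻¹ * ((n : ℝ)⁻¹ * n ^ (-β)) :=
          Finset.sum_le_sum fun μ hμ => Finset.sum_le_sum fun v _ =>
            htail μ (Finset.mem_filter.1 hμ).2 v
      _ ≤ ∑ _μ : Fin k → ZMod 2, ∑ _v : V, ((2 : ℝ) ^ k)⁻¹ * ((n : ℝ)⁻¹ * n ^ (-β)) :=
          Finset.sum_le_sum_of_subset_of_nonneg (Finset.filter_subset _ _)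
            fun _ _ _ => by positivity
      _ = (n : ℝ) ^ (-β) := by
          simp only [Finset.sum_const, Finset.card_univ, nsmul_eq_mul, ← hn, Fintype.card_fun,
            ZMod.card, Fintype.card_fin]
          push_cast
          field_simp
  have hsucc := RadioNC.one_sub_sum_ignorance_le_successProb G color lam nu s msg T
  exact (sub_le_sub_left hunion 1).trans hsucc
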